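/- Let $N$ oscillators have natural frequencies $\omega\in\mathbb R^N$, and let the edges of the complete graph on $\{1,\dots,N\}$ be the $e=\binom N2$ pairs $i<j$. Let $B\in\mathbb R^{N\times e}$ be its incidence matrix, so that $(B^\top\theta)_{(i,j)}=\theta_i-\theta_j$. Let $\tilde K\in\mathbb R^e$ be the vector of coupling gains, $\tilde K_i\ge 0$ (a missing link has gain $0$), and let $K=\frac1N\operatorname{diag}(\tilde K)$. The $N$-oscillator difference system, for $(X,V)\in\mathbb R^e\times\mathbb R^e$, is $$\dot X=V,\qquad \dot V=G(X)V,\qquad G(X)=-B^\top BK\operatorname{diag}(\cos X).\tag{1}$$ Let $f(X)=B^\top\omega-B^\top BK\sin X$, with $\sin$ taken coordinatewise, which is the value of $V=B^\top\dot\theta$ for Kuramoto oscillators with phase differences $X=B^\top\theta$. Say that the gains satisfy (2) if for every edge $i$ and every $X\in[-\frac\pi2,\frac\pi2]^e\cap\operatorname{Col}(B^\top)$ on a bounding surface $x_i=\pm\frac\pi2$, $$|e_i^\top B^\top\omega|\le\frac2N\tilde K_i+\frac1N\sum_{j\ne i}|(B^\top B)_{ij}|\,\tilde K_j\sin|x_j|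 .\tag{2}$$ For $0<\delta<\frac\pi2$ let $$\mathcal H=\{(X,V): X\in(-\tfrac\pi2,\tfrac\pi2)^e\cap\operatorname{Col}(B^\top),\ V=f(X),\ \text{(2) holds}\},$$ $$\mathcal M=\{(X,V): X\in(-\pi+\delta,\pi-\delta]^e\cap\operatorname{Col}(B^\top),\ V=f(X),\ \text{(2) holds}\}.$$ Let $\Delta_m=\tilde K_{\max}-\tilde K_{\min}$, the maximum and the minimum being taken over all $e$ edges. Suppose that every nonzero $\tilde K_i$ satisfies $\tilde K_i\ge\frac{N-2}2\Delta_m$ and that $$\frac1N\sum_{i:\,\tilde K_i>0}\bigl(2\tilde K_i-(N-2)\Delta_m\bigr)\sin|\delta|\;>\;\sum_{i=1}^e|e_i^\top B^\top\omega|+\frac1N\sum_{i:\,\tilde K_i=0}(N-2)\Delta_m .$$ **Proposition.** There is a nonempty, connected, compact set $\mathcal N$ with $\mathcal H\subseteq\mathcal N\subseteq\mathcal M$ that is positively invariant for (1), such that $\mathcal H$ is an attracting set of (1) in $\mathcal M$ with trapping neighbourhood $\mathcal N$: $\mathcal H$ is positively invariant, $\overline{\mathcal H}\subseteq\mathcal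 M$, $\mathcal N$ is a neighbourhood of $\overline{\mathcal H}$ relative to $\mathcal M$, and for every solution $z$ of (1) on $[0,\infty)$ with $z(0)\in\mathcal M$ (in particular with $z(0)\in\mathcal N$), the distance from $z(t)$ to $\mathcal H$ tends to $0$ as $t\to\infty$. (A set is positively invariant if every solution on an interval $[0,T]$ that starts in it stays in it.) -/

import Mathlib

open Set Filter Topology Matrix

namespace Kuramoto

noncomputable section

/-- The edges of the complete graph on the oscillators `0, …, n - 1`, as pairs `i < j`. -/
abbrev Edge (n : ℕ) : Type := {p : Fin n × Fin n // p.1 < p.2}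

/-- The incidence matrix of the complete graph: the edge `(i, j)`, `i < j`, has the entry `1` at `i`
and `-1` at `j`, so that `(Bᵀ θ)` has the entry `θ i - θ j` at `(i, j)`. -/
def incidence (n : ℕ) : Matrix (Fin n) (Edge n) ℝ :=
  Matrix.of fun i e => if i = e.1.1 then 1 else if i = e.1.2 then -1 else 0

/-- The coupling strength matrix `K = (1/N) diag K̃`, for the vector `k = K̃` of coupling gains. -/
def couplingMatrix {n : ℕ} (k : Edge n → ℝ) : Matrix (Edge n) (Edge n) ℝ :=
  (1 / (n : ℝ)) • Matrix.diagonal k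

/-- The column space of `Bᵀ`. -/
def colSpace (n : ℕ) : Set (Edge n → ℝ) := Set.range fun θ : Fin n → ℝ => (incidence n)ᵀ *ᵥ θ

/-- The matrix `G(X) = -Bᵀ B K diag (cos X)`. -/
def gMatrix {n : ℕ} (k : Edge n → ℝ) (X : Edge n → ℝ) : Matrix (Edge n) (Edge n) ℝ :=
  -((incidence n)ᵀ * incidence n * couplingMatrix k * Matrix.diagonal fun e => Real.cos (X e))

/-- The vector field `F(X, V) = (V, G(X) V)` of the `N`-oscillator difference system. -/
def field {n : ℕ} (k : Edge n → ℝ) (z : (Edge n → ℝ) × (Edge n → ℝ)) :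
    (Edge n → ℝ) × (Edge n → ℝ) :=
  (z.2, gMatrix k z.1 *ᵥ z.2)

/-- The frequency differences `Bᵀ θ̇ = Bᵀ ω - Bᵀ B K sin X` of the oscillators with phase
differences `X`. -/
def velocity {n : ℕ} (ω : Fin n → ℝ) (k : Edge n → ℝ) (X : Edge n → ℝ) : Edge n → ℝ :=
  (incidence n)ᵀ *ᵥ ω -
    ((incidence n)ᵀ * incidence n * couplingMatrix k) *ᵥ fun e => Real.sin (X e)

/-- The bound on the coupling gains that is part of the definition of the set of velocities:
`|eᵢᵀ Bᵀ ω| ≤ (2/N) K̃ᵢ + (1/N) ∑_{j ≠ i} |(Bᵀ B)ᵢⱼ| K̃ⱼ sin |xⱼ|` for every edge `i`, on the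
`i`-th bounding surfaces `xᵢ = ± π / 2` of the cube `[-π/2, π/2]^e`, within the column space. -/
def CouplingBound {n : ℕ} (ω : Fin n → ℝ) (k : Edge n → ℝ) : Prop :=
  ∀ i : Edge n, ∀ x ∈ colSpace n, (∀ j, |x j| ≤ Real.pi / 2) → |x i| = Real.pi / 2 →
    |((incidence n)ᵀ *ᵥ ω) i| ≤
      2 / (n : ℝ) * k i + 1 / (n : ℝ) *
        ∑ j ∈ Finset.univ.erase i,
          |((incidence n)ᵀ * incidence n) i j| * k j * Real.sin |x j|

/-- The set `H`: phase differences in the open cube `(-π/2, π/2)^e`. -/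
def setH {n : ℕ} (ω : Fin n → ℝ) (k : Edge n → ℝ) : Set ((Edge n → ℝ) × (Edge n → ℝ)) :=
  {z | (∀ e, z.1 e ∈ Set.Ioo (-(Real.pi / 2)) (Real.pi / 2)) ∧ z.1 ∈ colSpace n ∧
    z.2 = velocity ω k z.1 ∧ CouplingBound ω k}

/-- The set `M`: phase differences in the cube `(-π + δ, π - δ]^e`. -/
def setM {n : ℕ} (ω : Fin n → ℝ) (k : Edge n → ℝ) (δ : ℝ) :
    Set ((Edge n → ℝ) × (Edge n → ℝ)) :=
  {z | (∀ e, z.1 e ∈ Set.Ioc (-Real.pi + δ) (Real.pi - δ)) ∧ z.1 ∈ colSpace n ∧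
    z.2 = velocity ω k z.1 ∧ CouplingBound ω k}

/-- `Δ_m = K̃_max - K̃_min`, over all edges of the complete graph. -/
def gainSpread {n : ℕ} (k : Edge n → ℝ) : ℝ := (⨆ e, k e) - ⨅ e, k e

section Dynamics

variable {E : Type*} [NormedAddCommGroup E] [NormedSpace ℝ E]

/-- `A` is positively invariant for `ż = F(z)`: a solution, on an interval `[0, T]` of any length,
that starts in `A` remains in `A`. -/
def PositivelyInvariant (F : E → E) (A : Set E) : Prop :=
  ∀ (T : ℝ) (z : ℝ → E), IsIntegralCurveOn z (fun _ => F) (Set.Icc 0 T) → z 0 ∈ A →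
    ∀ t ∈ Set.Icc 0 T, z t ∈ A

/-- `A` is an attracting set of `ż = F(z)` in `M`, with the trapping neighbourhood `U`: both `A` and
`U` are positively invariant, `U` is a neighbourhood of the closure of `A` relative to `M`, and every
solution on `[0, ∞)` that starts in `M` converges to `A`. -/
def IsAttractingSetIn (F : E → E) (M A U : Set E) : Prop :=
  PositivelyInvariant F A ∧ PositivelyInvariant F U ∧ closure A ⊆ M ∧ U ⊆ M ∧
    (∀ x ∈ closure A, U ∈ 𝓝[M] x) ∧
    ∀ z : ℝ → E, IsIntegralCurveOn z (fun _ => F) (Set.Ici 0) → z 0 ∈ M →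
      ∀ ε > 0, ∀ᶠ t in atTop, z t ∈ Metric.thickening ε A

end Dynamics

end

end Kuramoto

namespace Kuramoto

noncomputable section

/-! On the graph `V = f(X)` the system is the Kuramoto flow, and this graph is invariant because
`G(X)V` is the derivative of `f(X)` along `X' = V`. Everything therefore reduces to the phase
differences. If `θ a` and `θ b` are the largest and smallest phases, at distance `d ∈ [δ, π - δ]`,
every other oscillator lies between them, and subadditivity of sine makes it pull the pair together
with weight at least `min (symGain k a c) (symGain k b c)` times `sin d ≥ sin δ`
(`pairGain_mul_sin_le`).

The gain condition, compared with an arbitrary pair by counting edges (`sum_gain_sub_spread_le`,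
`mul_abs_sub_le_sum_edge`), makes this pull exceed the frequency difference by a uniform margin `η >
0` (`exists_rate`). So every cube of half-width in `[δ, π - δ]` has inward velocity at least `η` on
its faces (`velocity_le_neg`). Constant barriers then give invariance and a shrinking one gives
attraction (`abs_fst_le_barrier`). The same margin implies bound (2), and `𝒩` is the graph of `f`
over a closed cube of half-width strictly between `π/2` and `π - δ`. -/

/-! ### Sums over edges and sums over pairs of oscillators. -/

/-- The coupling gains as a symmetric function of two oscillators, zero on the diagonal. -/
def symGain {n : ℕ} (k : Edge n → ℝ) (a b : Fin n) : ℝ :=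
  if h : a < b then k ⟨(a, b), h⟩ else if h : b < a then k ⟨(b, a), h⟩ else 0

lemma symGain_comm {n : ℕ} (k : Edge n → ℝ) (a b : Fin n) : symGain k a b = symGain k b a := by
  unfold symGain
  rcases lt_trichotomy a b with h | h | h
  · simp [h, h.not_gt]
  · simp [h]
  · simp [h, h.not_gt]

lemma symGain_edge {n : ℕ} (k : Edge n → ℝ) (e : Edge n) : symGain k e.1.1 e.1.2 = k e := by
  simp [symGain, e.2]

lemma exists_edge_symGain_eq {n : ℕ} (k : Edge n → ℝ) {a b : Fin n} (h : a ≠ b) :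
    ∃ e, symGain k a b = k e := by
  rcases lt_or_gt_of_ne h with h | h
  · exact ⟨⟨(a, b), h⟩, symGain_edge k ⟨(a, b), h⟩⟩
  · exact ⟨⟨(b, a), h⟩, by rw [symGain_comm]; exact symGain_edge k ⟨(b, a), h⟩⟩

lemma symGain_nonneg {n : ℕ} {k : Edge n → ℝ} (hk : ∀ e, 0 ≤ k e) (a b : Fin n) :
    0 ≤ symGain k a b := by
  unfold symGain
  split_ifs <;> simp [hk]

lemma sum_edge {n : ℕ} (F : Fin n → Fin n → ℝ) :
    ∑ e : Edge n, F e.1.1 e.1.2 = ∑ p, ∑ q, if p < q then F p q else 0 := by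
  rw [← Fintype.sum_prod_type' (fun p q : Fin n => if p < q then F p q else 0),
    ← Finset.sum_filter]
  exact (Finset.sum_subtype _ (by simp) (fun x : Fin n × Fin n => F x.1 x.2)).symm

/-- A sum over all pairs of a symmetric function that vanishes on the diagonal is twice its sum over
the edges. -/
lemma sum_sum_eq_two_mul_sum_edge {n : ℕ} (F : Fin n → Fin n → ℝ) (hs : ∀ p q, F p q = F q p)
    (h0 : ∀ p, F p p = 0) : ∑ p, ∑ q, F p q = 2 * ∑ e : Edge n, F e.1.1 e.1.2 := by
  have h1 : ∑ p, ∑ q, F p q =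
      (∑ p, ∑ q, if p < q then F p q else 0) + ∑ p, ∑ q, if q < p then F q p else 0 := by
    simp only [← Finset.sum_add_distrib]
    refine Finset.sum_congr rfl fun p _ => Finset.sum_congr rfl fun q _ => ?_
    rcases lt_trichotomy p q with h | h | h
    · simp [h, h.not_gt]
    · simp [h, h0]
    · simp [h, h.not_gt, hs p q]
  rw [h1, sum_edge, Finset.sum_comm (f := fun p q : Fin n => if q < p then F q p else 0)]
  ring

lemma incidence_eq {n : ℕ} (a : Fin n) (e : Edge n) :
    incidence n a e = (if a = e.1.1 then 1 else 0) - (if a = e.1.2 then 1 else 0) := by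
  have := e.2.ne
  unfold incidence
  by_cases h : a = e.1.1
  · subst h; simp [this]
  · by_cases h' : a = e.1.2
    · subst h'; simp [this.symm]
    · simp [h, h']

lemma transpose_mulVec_apply {n : ℕ} (θ : Fin n → ℝ) (e : Edge n) :
    ((incidence n)ᵀ *ᵥ θ) e = θ e.1.1 - θ e.1.2 := by
  simp [mulVec, dotProduct, incidence_eq, sub_mul, Finset.sum_sub_distrib]

lemma gram_apply {n : ℕ} (i j : Edge n) :
    ((incidence n)ᵀ * incidence n) i j = incidence n i.1.1 j - incidence n i.1.2 j := by
  rw [← transpose_mulVec_apply (fun a => incidence n a j)]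
  rfl

/-- Antisymmetry of `g` cancels the orientation sign of each edge, so the contributions of all edges
at `a` add up with the same sign. -/
lemma sum_incidence_mul {n : ℕ} (a : Fin n) (g : Fin n → Fin n → ℝ) (hg : ∀ p q, g p q = -g q p) :
    ∑ e : Edge n, incidence n a e * g e.1.1 e.1.2 = ∑ c, g a c := by
  have h := sum_sum_eq_two_mul_sum_edge
    (fun p q => ((if a = p then 1 else 0) - (if a = q then 1 else 0)) * g p q)
    (fun p q => by rw [hg p q]; ring) (fun p => by simp)
  simp only [incidence_eq]
  simp only [sub_mul, Finset.sum_sub_distrib, ite_mul, one_mul, zero_mul] at h ⊢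
  rw [Finset.sum_comm] at h
  simp only [Finset.sum_ite_eq, Finset.mem_univ, if_true] at h
  have h2 : ∑ p, g p a = -∑ p, g a p := by
    rw [← Finset.sum_neg_distrib]; exact Finset.sum_congr rfl fun p _ => hg p a
  rw [h2] at h
  linarith

/-- The torque on oscillator `a`. -/
def torque {n : ℕ} (k : Edge n → ℝ) (θ : Fin n → ℝ) (a : Fin n) : ℝ :=
  ∑ c, symGain k a c * Real.sin (θ a - θ c)

lemma sum_incidence_mul_sin {n : ℕ} (k : Edge n → ℝ) (θ : Fin n → ℝ) (a : Fin n) :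
    ∑ e, incidence n a e * (k e * Real.sin (((incidence n)ᵀ *ᵥ θ) e)) = torque k θ a := by
  rw [torque, ← sum_incidence_mul a (fun p q => symGain k p q * Real.sin (θ p - θ q))]
  · simp only [symGain_edge, transpose_mulVec_apply]
  · intro p q
    rw [symGain_comm, ← neg_sub (θ q), Real.sin_neg]; ring

lemma velocity_eq {n : ℕ} (ω : Fin n → ℝ) (k : Edge n → ℝ) (X : Edge n → ℝ) :
    velocity ω k X = (incidence n)ᵀ *ᵥ
      fun a => ω a - 1 / (n : ℝ) * ∑ e, incidence n a e * (k e * Real.sin (X e)) := by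
  have h : (fun a => ω a - 1 / (n : ℝ) * ∑ e, incidence n a e * (k e * Real.sin (X e))) =
      ω - (incidence n * couplingMatrix k) *ᵥ fun e => Real.sin (X e) := by
    ext a
    simp [couplingMatrix, mulVec, dotProduct, Matrix.mul_diagonal, Finset.mul_sum, mul_assoc]
  rw [h, mulVec_sub, mulVec_mulVec, velocity, Matrix.mul_assoc]

lemma velocity_mem_colSpace {n : ℕ} (ω : Fin n → ℝ) (k : Edge n → ℝ) (X : Edge n → ℝ) :
    velocity ω k X ∈ colSpace n := ⟨_, (velocity_eq ω k X).symm⟩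

lemma velocity_apply {n : ℕ} (ω : Fin n → ℝ) (k : Edge n → ℝ) (θ : Fin n → ℝ) (e : Edge n) :
    velocity ω k ((incidence n)ᵀ *ᵥ θ) e =
      ω e.1.1 - ω e.1.2 - 1 / (n : ℝ) * (torque k θ e.1.1 - torque k θ e.1.2) := by
  rw [velocity_eq, transpose_mulVec_apply]
  simp only [sum_incidence_mul_sin]
  ring

/-! ### From the gain condition to a uniform margin for every pair. -/

/-- The oscillators other than `a` and `b`. -/
def others {n : ℕ} (a b : Fin n) : Finset (Fin n) := (Finset.univ.erase a).erase b

lemma sum_eq_add_sum_others {n : ℕ} {a b : Fin n} (hab : a ≠ b) (f : Fin n → ℝ) :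
    ∑ p, f p = f a + f b + ∑ p ∈ others a b, f p := by
  rw [others, add_assoc, Finset.add_sum_erase _ _ (by simp [hab.symm]),
    Finset.add_sum_erase _ _ (Finset.mem_univ a)]

lemma card_others {n : ℕ} {a b : Fin n} (hab : a ≠ b) : ((others a b).card : ℝ) = n - 2 := by
  have h := sum_eq_add_sum_others hab (fun _ => 1)
  simp at h
  linarith

lemma sum_sum_eq_add_sum_others {n : ℕ} {a b : Fin n} (hab : a ≠ b) (F : Fin n → Fin n → ℝ)
    (hs : ∀ p q, F p q = F q p) (h0 : ∀ p, F p p = 0) :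
    ∑ p, ∑ q, F p q = 2 * F a b + 2 * ∑ c ∈ others a b, (F a c + F b c) +
      ∑ p ∈ others a b, ∑ q ∈ others a b, F p q := by
  have h : ∀ x, ∑ p ∈ others a b, F p x = ∑ p ∈ others a b, F x p := fun x =>
    Finset.sum_congr rfl fun p _ => hs p x
  simp only [sum_eq_add_sum_others hab, h0, Finset.sum_add_distrib, hs b a, h]
  ring

lemma two_mul_card_edge (n : ℕ) : 2 * (Fintype.card (Edge n) : ℝ) = n * (n - 1) := by
  have h := sum_sum_eq_two_mul_sum_edge (n := n) (fun p q => 1 - if p = q then 1 else 0)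
    (fun p q => by simp [eq_comm]) (by simp)
  have h' : ∀ e : Edge n, (1 : ℝ) - (if e.1.1 = e.1.2 then 1 else 0) = 1 := fun e => by
    simp [e.2.ne]
  simp only [h'] at h
  simp at h
  linarith

/-- In `∑ |ωᵢ - ωⱼ|`, every single difference is dominated `n - 1` times. -/
lemma mul_abs_sub_le_sum_edge {n : ℕ} (ω : Fin n → ℝ) {a b : Fin n} (hab : a ≠ b) :
    ((n : ℝ) - 1) * |ω a - ω b| ≤ ∑ e : Edge n, |ω e.1.1 - ω e.1.2| := by
  have h1 := sum_sum_eq_two_mul_sum_edge (fun p q => |ω p - ω q|) (fun p q => abs_sub_comm _ _)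
    (by simp)
  rw [sum_sum_eq_add_sum_others hab _ (fun p q => abs_sub_comm _ _) (by simp)] at h1
  have h2 : ((n : ℝ) - 2) * |ω a - ω b| ≤
      ∑ c ∈ others a b, (|ω a - ω c| + |ω b - ω c|) := by
    rw [← card_others hab, ← nsmul_eq_mul]
    refine Finset.card_nsmul_le_sum _ _ _ fun c _ => ?_
    rw [abs_sub_comm (ω b)]
    exact abs_sub_le _ _ _
  have h3 : 0 ≤ ∑ p ∈ others a b, ∑ q ∈ others a b, |ω p - ω q| :=
    Finset.sum_nonneg fun _ _ => Finset.sum_nonneg fun _ _ => abs_nonneg _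
  linarith

/-- The total coupling across the pair `a`, `b` that is available at large phase differences. -/
def pairGain {n : ℕ} (k : Edge n → ℝ) (a b : Fin n) : ℝ :=
  2 * symGain k a b + ∑ c ∈ others a b, min (symGain k a c) (symGain k b c)

lemma iInf_le_gain {n : ℕ} (k : Edge n → ℝ) (e : Edge n) : ⨅ e, k e ≤ k e :=
  ciInf_le (Set.finite_range k).bddBelow e

lemma gain_le_iSup {n : ℕ} (k : Edge n → ℝ) (e : Edge n) : k e ≤ ⨆ e, k e :=
  le_ciSup (Set.finite_range k).bddAbove e

/-- Split the edges by how many of `a`, `b` they meet. Bound the edges missing both, and the larger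
of each two gains to a common `c`, by `M`; bound `symGain k a b` and the minima below by `m`. What
remains is `(n - 1)(n - 2)²(M - m)/2 ≥ 0`. -/
lemma sum_gain_sub_spread_le {n : ℕ} (k : Edge n → ℝ) {a b : Fin n} (hab : a ≠ b) :
    ∑ e, (2 * k e - ((n : ℝ) - 2) * gainSpread k) ≤ ((n : ℝ) - 1) * pairGain k a b := by
  set m := ⨅ e, k e with hm
  set M := ⨆ e, k e with hM
  have hlo : ∀ p q : Fin n, p ≠ q → m ≤ symGain k p q := fun p q h => by
    obtain ⟨e, he⟩ := exists_edge_symGain_eq k h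
    rw [he]; exact iInf_le_gain k e
  have hhi : ∀ p q : Fin n, p ≠ q → symGain k p q ≤ M := fun p q h => by
    obtain ⟨e, he⟩ := exists_edge_symGain_eq k h
    rw [he]; exact gain_le_iSup k e
  have h0 : ∀ p, symGain k p p = 0 := fun p => by simp [symGain]
  have hmem : ∀ c ∈ others a b, a ≠ c ∧ b ≠ c := fun c hc => by
    simp only [others, Finset.mem_erase, Finset.mem_univ, and_true] at hc
    exact ⟨hc.2.symm, hc.1.symm⟩
  have hmM : m ≤ M := (hlo a b hab).trans (hhi a b hab)
  have h1 := sum_sum_eq_two_mul_sum_edge (symGain k) (symGain_comm k) h0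
  rw [sum_sum_eq_add_sum_others hab _ (symGain_comm k) h0] at h1
  simp only [symGain_edge] at h1
  have hcard := card_others hab
  have h2 : ∑ c ∈ others a b, (symGain k a c + symGain k b c) ≤
      ∑ c ∈ others a b, min (symGain k a c) (symGain k b c) + ((n : ℝ) - 2) * M := by
    rw [← hcard, ← nsmul_eq_mul, ← Finset.sum_const, ← Finset.sum_add_distrib]
    refine Finset.sum_le_sum fun c hc => ?_
    rw [← min_add_max]
    have := max_le (hhi a c (hmem c hc).1) (hhi b c (hmem c hc).2)
    linarith
  have h3 : ∑ p ∈ others a b, ∑ q ∈ others a b, symGain k p q ≤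
      ((n : ℝ) - 2) * (((n : ℝ) - 3) * M) := by
    rw [← hcard, ← nsmul_eq_mul]
    refine Finset.sum_le_card_nsmul _ _ _ fun p hp => ?_
    rw [← Finset.add_sum_erase _ _ hp, h0, zero_add]
    have h4 : (((others a b).erase p).card : ℝ) = n - 3 := by
      rw [Finset.cast_card_erase_of_mem hp, hcard]; ring
    rw [← h4, ← nsmul_eq_mul]
    exact Finset.sum_le_card_nsmul _ _ _ fun q hq => hhi p q (Finset.ne_of_mem_erase hq).symm
  have h5 : ((n : ℝ) - 2) * m ≤ ∑ c ∈ others a b, min (symGain k a c) (symGain k b c) := by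
    rw [← hcard, ← nsmul_eq_mul]
    exact Finset.card_nsmul_le_sum _ _ _ fun c hc =>
      le_min (hlo a c (hmem c hc).1) (hlo b c (hmem c hc).2)
  have hn : 0 ≤ (n : ℝ) - 2 := by rw [← hcard]; positivity
  -- The factor `n - 3` is negative for `n = 2`, but then there are no other oscillators and the
  -- second factor vanishes.
  have h6 : 0 ≤ ((n : ℝ) - 3) *
      (∑ c ∈ others a b, min (symGain k a c) (symGain k b c) - ((n : ℝ) - 2) * m) := by
    rcases hn.eq_or_lt with h | h
    · have : others a b = ∅ := by
        rw [← h] at hcard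
        exact Finset.card_eq_zero.1 (by exact_mod_cast hcard)
      rw [this, ← h]; simp
    · have h' : (2 : ℝ) < n := by linarith
      have h'' : (3 : ℝ) ≤ n := by exact_mod_cast (by exact_mod_cast h' : 2 < n)
      exact mul_nonneg (by linarith) (by linarith)
  have h7 : 0 ≤ ((n : ℝ) - 2) * (symGain k a b - m) :=
    mul_nonneg hn (sub_nonneg.2 (hlo a b hab))
  have h8 : 0 ≤ ((n : ℝ) - 2) * ((n : ℝ) - 1) * ((n : ℝ) - 2) * (M - m) :=
    mul_nonneg (mul_nonneg (mul_nonneg hn (by linarith)) hn) (sub_nonneg.2 hmM)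
  have hc := two_mul_card_edge n
  rw [Finset.sum_sub_distrib, ← Finset.mul_sum, Finset.sum_const, Finset.card_univ, nsmul_eq_mul,
    gainSpread, ← hm, ← hM, pairGain]
  have h9 : (Fintype.card (Edge n) : ℝ) = n * (n - 1) / 2 := by linarith
  rw [h9]
  nlinarith

lemma exists_rate {n : ℕ} (ω : Fin n → ℝ) (k : Edge n → ℝ) {δ : ℝ} (hk : ∀ e, 0 ≤ k e)
    (hδ : 0 < δ) (hδ' : δ < Real.pi / 2)
    (hcond :
      1 / (n : ℝ) * ∑ e with 0 < k e,
          (2 * k e - ((n : ℝ) - 2) * gainSpread k) * Real.sin |δ| >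
        ∑ e, |((incidence n)ᵀ *ᵥ ω) e| +
          1 / (n : ℝ) * ∑ e : Edge n with k e = 0, ((n : ℝ) - 2) * gainSpread k) :
    ∃ η > 0, ∀ a b : Fin n, a ≠ b →
      (n : ℝ) * (|ω a - ω b| + η) ≤ pairGain k a b * Real.sin δ := by
  have hsin : 0 ≤ Real.sin δ := Real.sin_nonneg_of_nonneg_of_le_pi hδ.le (by linarith)
  simp only [transpose_mulVec_apply, abs_of_pos hδ] at hcond
  obtain ⟨g, hg, hg'⟩ : ∃ g > 0, _ = _ + g := ⟨_, sub_pos.2 hcond, (add_sub_cancel _ _).symm⟩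
  -- `g` is the slack in the gain condition; the denominator keeps `(n - 1) η ≤ g` and is positive
  -- even for `n = 0`.
  refine ⟨g / (n + 1), by positivity, fun a b hab => ?_⟩
  have hn : 2 ≤ (n : ℝ) := by
    have := card_others hab
    have h : (0 : ℝ) ≤ (others a b).card := by positivity
    linarith
  obtain ⟨e, -⟩ := exists_edge_symGain_eq k hab
  have hΔ : 0 ≤ ((n : ℝ) - 2) * gainSpread k :=
    mul_nonneg (by linarith) (sub_nonneg.2 ((iInf_le_gain k e).trans (gain_le_iSup k e)))
  -- A missing link contributes `-(n - 2) Δ_m sin δ` to the full sum, which is at least the `-(n -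
  -- 2) Δ_m` charged to it, as `sin δ ≤ 1`.
  have h1 : (∑ e with 0 < k e, (2 * k e - ((n : ℝ) - 2) * gainSpread k) * Real.sin δ) -
      ∑ e : Edge n with k e = 0, ((n : ℝ) - 2) * gainSpread k ≤
      (∑ e, (2 * k e - ((n : ℝ) - 2) * gainSpread k)) * Real.sin δ := by
    rw [Finset.sum_filter, Finset.sum_filter, ← Finset.sum_sub_distrib, Finset.sum_mul]
    refine Finset.sum_le_sum fun e _ => ?_
    rcases (hk e).eq_or_lt with h | h
    · simp only [← h]
      simp
      nlinarith [Real.sin_le_one δ]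
    · simp [h, h.ne']
  have h2 := mul_le_mul_of_nonneg_right (sum_gain_sub_spread_le k hab) hsin
  have h3 := mul_abs_sub_le_sum_edge ω hab
  have h4 : ((n : ℝ) - 1) * (g / (n + 1)) ≤ g := by
    rw [mul_div_assoc', div_le_iff₀ (by positivity)]
    nlinarith
  have h5 : ((n : ℝ) - 1) * (|ω a - ω b| + g / (n + 1)) ≤
      1 / n * (((n : ℝ) - 1) * pairGain k a b * Real.sin δ) := by
    have := mul_le_mul_of_nonneg_left (h1.trans h2) (by positivity : (0 : ℝ) ≤ 1 / n)
    rw [mul_sub] at this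
    linarith
  have h6 : (0 : ℝ) < n - 1 := by linarith
  refine le_of_mul_le_mul_left ?_ h6
  rw [one_div, ← div_eq_inv_mul, le_div_iff₀ (by linarith)] at h5
  linarith

/-! ### Inward velocity on the faces of cubes, and bound (2). -/

lemma sin_add_le_sin_add_sin {u v : ℝ} (hu : 0 ≤ u) (hv : 0 ≤ v) (h : u + v ≤ Real.pi) :
    Real.sin (u + v) ≤ Real.sin u + Real.sin v := by
  rw [Real.sin_add]
  have h1 := Real.sin_nonneg_of_nonneg_of_le_pi hu (by linarith)
  have h2 := Real.sin_nonneg_of_nonneg_of_le_pi hv (by linarith)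
  nlinarith [Real.cos_le_one u, Real.cos_le_one v]

lemma sin_le_sin_of_mem_Icc {δ d : ℝ} (hδ : 0 < δ) (h1 : δ ≤ d) (h2 : d ≤ Real.pi - δ) :
    Real.sin δ ≤ Real.sin d := by
  rcases le_total d (Real.pi / 2) with h | h
  · exact Real.sin_le_sin_of_le_of_le_pi_div_two (by linarith) h h1
  · rw [← Real.sin_pi_sub d]
    exact Real.sin_le_sin_of_le_of_le_pi_div_two (by linarith) (by linarith) (by linarith)

/-- The coupling pulls the two extreme oscillators towards each other. -/
lemma pairGain_mul_sin_le {n : ℕ} {k : Edge n → ℝ} (hk : ∀ e, 0 ≤ k e) {δ : ℝ} (hδ : 0 < δ)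
    {θ : Fin n → ℝ} {a b : Fin n} (hab : a ≠ b) (hθ : ∀ p q, θ p - θ q ≤ θ a - θ b)
    (h1 : δ ≤ θ a - θ b) (h2 : θ a - θ b ≤ Real.pi - δ) :
    pairGain k a b * Real.sin δ ≤ torque k θ a - torque k θ b := by
  have hsin := sin_le_sin_of_mem_Icc hδ h1 h2
  have hsum : pairGain k a b * Real.sin (θ a - θ b) ≤ torque k θ a - torque k θ b := by
    have h0 : Real.sin (θ b - θ a) = -Real.sin (θ a - θ b) := by rw [← Real.sin_neg, neg_sub]
    simp only [torque, sum_eq_add_sum_others hab, sub_self,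
      Real.sin_zero, h0, symGain_comm k b a, pairGain, add_mul, Finset.sum_mul]
    have : ∑ c ∈ others a b, min (symGain k a c) (symGain k b c) * Real.sin (θ a - θ b) ≤
        ∑ c ∈ others a b, (symGain k a c * Real.sin (θ a - θ c) -
          symGain k b c * Real.sin (θ b - θ c)) := by
      -- Extremality of `a` and `b` splits the gap into nonnegative parts `u = θ a - θ c` and `v = θ
      -- c - θ b`; both sines are nonnegative, so each gain may be lowered to the minimum.
      refine Finset.sum_le_sum fun c _ => ?_
      have hu : 0 ≤ θ a - θ c := by have := hθ c b; linarith
      have hv : 0 ≤ θ c - θ b := by have := hθ a c; linarith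
      have h3 := sin_add_le_sin_add_sin hu hv (by linarith)
      rw [sub_add_sub_cancel] at h3
      have h4 := Real.sin_nonneg_of_nonneg_of_le_pi hu (by linarith)
      have h5 := Real.sin_nonneg_of_nonneg_of_le_pi hv (by linarith)
      have h9 : Real.sin (θ b - θ c) = -Real.sin (θ c - θ b) := by rw [← Real.sin_neg, neg_sub]
      rw [h9]
      have h6 := mul_le_mul_of_nonneg_left h3
        (le_min (symGain_nonneg hk a c) (symGain_nonneg hk b c))
      have h7 := mul_le_mul_of_nonneg_right (min_le_left (symGain k a c) (symGain k b c)) h4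
      have h8 := mul_le_mul_of_nonneg_right (min_le_right (symGain k a c) (symGain k b c)) h5
      linarith
    rw [Finset.sum_sub_distrib] at this
    linarith
  refine le_trans (mul_le_mul_of_nonneg_left hsin ?_) hsum
  exact add_nonneg (mul_nonneg two_pos.le (symGain_nonneg hk a b))
    (Finset.sum_nonneg fun c _ => le_min (symGain_nonneg hk a c) (symGain_nonneg hk b c))

lemma sub_le_of_forall_abs_le {n : ℕ} {θ : Fin n → ℝ} {d : ℝ} (hd : 0 ≤ d)
    (h : ∀ j, |((incidence n)ᵀ *ᵥ θ) j| ≤ d) (p q : Fin n) : θ p - θ q ≤ d := by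
  rcases lt_trichotomy p q with hpq | hpq | hpq
  · have := h ⟨(p, q), hpq⟩
    rw [transpose_mulVec_apply] at this
    exact (abs_le.1 this).2
  · simpa [hpq] using hd
  · have := h ⟨(q, p), hpq⟩
    rw [transpose_mulVec_apply, abs_sub_comm] at this
    exact (abs_le.1 this).2

section Rate

variable {n : ℕ} {ω : Fin n → ℝ} {k : Edge n → ℝ} {δ η : ℝ}

/-- On the surface of a cube, the velocity points inwards. -/
lemma velocity_le_neg (hk : ∀ e, 0 ≤ k e) (hδ : 0 < δ)
    (hη : ∀ a b : Fin n, a ≠ b → (n : ℝ) * (|ω a - ω b| + η) ≤ pairGain k a b * Real.sin δ)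
    {X : Edge n → ℝ} (hX : X ∈ colSpace n) {d : ℝ} (h1 : δ ≤ d) (h2 : d ≤ Real.pi - δ)
    (hd : ∀ j, |X j| ≤ d) (e : Edge n) :
    (X e = d → velocity ω k X e ≤ -η) ∧ (X e = -d → η ≤ velocity ω k X e) := by
  obtain ⟨θ, rfl⟩ := hX
  have hn : (0 : ℝ) < n := by exact_mod_cast e.1.1.pos
  have hle := sub_le_of_forall_abs_le (hδ.le.trans h1) hd
  -- Stated for ordered pairs, so that the face `X e = -d` is covered by exchanging the endpoints of
  -- `e`.
  have key : ∀ a b : Fin n, a ≠ b → θ a - θ b = d →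
      |ω a - ω b| + η ≤ 1 / n * (torque k θ a - torque k θ b) := by
    intro a b hab h
    have := (hη a b hab).trans (pairGain_mul_sin_le hk hδ hab (by rwa [h]) (by rwa [h]) (by rwa [h]))
    rw [one_div, ← div_eq_inv_mul, le_div_iff₀ hn]
    linarith
  simp only [velocity_apply, transpose_mulVec_apply]
  constructor
  · intro h
    have := key _ _ e.2.ne h
    have := le_abs_self (ω e.1.1 - ω e.1.2)
    linarith
  · intro h
    have := key _ _ e.2.ne' (by linarith)
    have := le_abs_self (ω e.1.2 - ω e.1.1)
    linarith

/-- This is the torque estimate at `d = π/2`: written over edges, the torque difference has the Gram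
entries as coefficients, edge `i` contributes `2 k i`, and the other terms are at most their
absolute values. -/
lemma couplingBound_of_rate (hk : ∀ e, 0 ≤ k e) (hδ : 0 < δ) (hδ' : δ < Real.pi / 2) (h0 : 0 < η)
    (hη : ∀ a b : Fin n, a ≠ b → (n : ℝ) * (|ω a - ω b| + η) ≤ pairGain k a b * Real.sin δ) :
    CouplingBound ω k := by
  have main : ∀ i : Edge n, ∀ x ∈ colSpace n, (∀ j, |x j| ≤ Real.pi / 2) → x i = Real.pi / 2 →
      |((incidence n)ᵀ *ᵥ ω) i| ≤ 2 / (n : ℝ) * k i + 1 / (n : ℝ) *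
        ∑ j ∈ Finset.univ.erase i,
          |((incidence n)ᵀ * incidence n) i j| * k j * Real.sin |x j| := by
    rintro i x ⟨θ, rfl⟩ hx hi
    have hn : (0 : ℝ) < n := by exact_mod_cast i.1.1.pos
    have hd : θ i.1.1 - θ i.1.2 = Real.pi / 2 := by rw [← transpose_mulVec_apply]; exact hi
    have hle := sub_le_of_forall_abs_le Real.pi_div_two_pos.le hx
    have h1 := (hη _ _ i.2.ne).trans (pairGain_mul_sin_le hk hδ i.2.ne (by rwa [hd])
      (by rw [hd]; exact hδ'.le) (by rw [hd]; linarith))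
    rw [← sum_incidence_mul_sin, ← sum_incidence_mul_sin, ← Finset.sum_sub_distrib,
      ← Finset.add_sum_erase _ _ (Finset.mem_univ i)] at h1
    have h2 : ∑ j ∈ Finset.univ.erase i,
        (incidence n i.1.1 j * (k j * Real.sin (((incidence n)ᵀ *ᵥ θ) j)) -
          incidence n i.1.2 j * (k j * Real.sin (((incidence n)ᵀ *ᵥ θ) j))) ≤
        ∑ j ∈ Finset.univ.erase i, |((incidence n)ᵀ * incidence n) i j| * k j *
          Real.sin |((incidence n)ᵀ *ᵥ θ) j| := by
      refine Finset.sum_le_sum fun j _ => ?_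
      rw [← sub_mul, ← gram_apply, mul_assoc]
      have h3 : Real.sin |((incidence n)ᵀ *ᵥ θ) j| = |Real.sin (((incidence n)ᵀ *ᵥ θ) j)| :=
        (Real.abs_sin_eq_sin_abs_of_abs_le_pi ((hx j).trans (by linarith [Real.pi_pos]))).symm
      rw [h3, ← abs_of_nonneg (hk j), ← abs_mul, ← abs_mul, abs_of_nonneg (hk j)]
      exact le_abs_self _
    have h4 : incidence n i.1.1 i = 1 := by simp [incidence]
    have h5 : incidence n i.1.2 i = -1 := by simp [incidence, i.2.ne']
    simp only [] at hi
    rw [h4, h5, hi, Real.sin_pi_div_two] at h1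
    rw [transpose_mulVec_apply, div_mul_eq_mul_div, one_div, ← div_eq_inv_mul, ← add_div,
      le_div_iff₀ hn]
    have h6 : 0 ≤ (n : ℝ) * η := by positivity
    linarith
  intro i x hx hx' hi
  rcases (abs_eq Real.pi_div_two_pos.le).1 hi with h | h
  · exact main i x hx hx' h
  -- The opposite face follows from the symmetry `x ↦ -x`.
  · obtain ⟨θ, rfl⟩ := hx
    have := main i (-((incidence n)ᵀ *ᵥ θ)) ⟨-θ, mulVec_neg _ _⟩ (fun j => by
      rw [Pi.neg_apply, abs_neg]; exact hx' j) (by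
      simp only [] at h
      rw [Pi.neg_apply, h, neg_neg])
    simpa only [Pi.neg_apply, abs_neg] using this

end Rate

/-! ### Barriers and invariance along solutions. -/

/-- Finitely many functions that start nonpositive, and that strictly decrease wherever they vanish
while all of them are nonpositive, remain nonpositive. -/
lemma nonpos_of_deriv_neg_of_eq_zero {ι : Type*} [Finite ι] {g g' : ι → ℝ → ℝ} {T : ℝ}
    (hd : ∀ i, ∀ t ∈ Icc 0 T, HasDerivWithinAt (g i) (g' i t) (Icc 0 T) t)
    (h : ∀ t ∈ Ico 0 T, (∀ j, g j t ≤ 0) → ∀ i, g i t = 0 → g' i t < 0)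
    (h0 : ∀ i, g i 0 ≤ 0) : ∀ t ∈ Icc 0 T, ∀ i, g i t ≤ 0 := by
  refine IsClosed.Icc_subset_of_forall_mem_nhdsWithin (s := {t | ∀ i, g i t ≤ 0}) ?_ h0 ?_
  · have : {t | ∀ i, g i t ≤ 0} ∩ Icc 0 T = Icc 0 T ∩ ⋂ i, (Icc 0 T ∩ g i ⁻¹' Iic 0) := by
      ext t
      simp only [mem_inter_iff, mem_ofPred_eq, mem_iInter, mem_preimage, mem_Iic]
      exact ⟨fun h => ⟨h.2, fun i => ⟨h.2, h.1 i⟩⟩, fun h => ⟨fun i => (h.2 i).2, h.1⟩⟩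
    rw [this]
    refine isClosed_Icc.inter (isClosed_iInter fun i => ?_)
    exact ContinuousOn.preimage_isClosed_of_isClosed
      (fun t ht => (hd i t ht).continuousWithinAt) isClosed_Icc isClosed_Iic
  · rintro t ⟨hts, ht⟩
    have ht' : t ∈ Icc 0 T := Ico_subset_Icc_self ht
    refine eventually_all.2 fun i => ?_
    have hd' : HasDerivWithinAt (g i) (g' i t) (Ioi t) t :=
      (hd i t ht').mono_of_mem_nhdsWithin
        (mem_of_superset (Ioc_mem_nhdsGT ht.2) fun s hs => ⟨ht.1.trans hs.1.le, hs.2⟩)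
    rcases (hts i).lt_or_eq with hlt | heq
    · exact (hd'.continuousWithinAt.eventually (gt_mem_nhds hlt)).mono fun s hs => le_of_lt hs
    · have hs := (hasDerivWithinAt_iff_tendsto_slope' self_notMem_Ioi).1 hd'
      -- A negative right derivative at a zero keeps the function negative just after it.
      filter_upwards [hs.eventually (gt_mem_nhds (h t ht hts i heq)), self_mem_nhdsWithin]
        with s hs hts
      rw [slope_def_field, heq, sub_zero] at hs
      exact ((div_neg_iff.1 hs).resolve_left fun h => h.2.not_gt (sub_pos.2 hts)).1.le

lemma eq_of_hasDerivWithinAt_zero {F : Type*} [NormedAddCommGroup F] [NormedSpace ℝ F]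
    {f : ℝ → F} {T : ℝ} (h : ∀ t ∈ Icc 0 T, HasDerivWithinAt f 0 (Icc 0 T) t) :
    ∀ t ∈ Icc 0 T, f t = f 0 :=
  constant_of_has_deriv_right_zero (fun t ht => (h t ht).continuousWithinAt) fun t ht =>
    (h t (Ico_subset_Icc_self ht)).mono_of_mem_nhdsWithin
      (mem_of_superset (Icc_mem_nhdsGE ht.2) (Icc_subset_Icc_left ht.1))

lemma hasDerivWithinAt_velocity {n : ℕ} (ω : Fin n → ℝ) (k : Edge n → ℝ) {X : ℝ → Edge n → ℝ}
    {V : Edge n → ℝ} {s : Set ℝ} {t : ℝ} (h : HasDerivWithinAt X V s t) :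
    HasDerivWithinAt (fun t => velocity ω k (X t)) (gMatrix k (X t) *ᵥ V) s t := by
  have hg : gMatrix k (X t) *ᵥ V = 0 - ((incidence n)ᵀ * incidence n * couplingMatrix k) *ᵥ
      fun e => Real.cos (X t e) * V e := by
    rw [gMatrix, neg_mulVec, zero_sub, ← mulVec_mulVec]
    congr 2
    ext e
    exact mulVec_diagonal _ _ _
  rw [hg]
  refine (hasDerivWithinAt_const _ _ _).sub ?_
  rw [hasDerivWithinAt_pi] at h ⊢
  intro e
  simp only [mulVec, dotProduct]
  exact HasDerivWithinAt.fun_sum fun j _ => ((h j).sin).const_mul _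

lemma continuous_velocity {n : ℕ} (ω : Fin n → ℝ) (k : Edge n → ℝ) :
    Continuous (velocity ω k) := by
  unfold velocity
  fun_prop

/-- The range of `Bᵀ` as a submodule. -/
def colSubmodule (n : ℕ) : Submodule ℝ (Edge n → ℝ) := LinearMap.range (incidence n)ᵀ.mulVecLin

lemma coe_colSubmodule (n : ℕ) : (colSubmodule n : Set (Edge n → ℝ)) = colSpace n := rfl

lemma isClosed_colSpace (n : ℕ) : IsClosed (colSpace n) :=
  coe_colSubmodule n ▸ (colSubmodule n).closed_of_finiteDimensional

section Flow

variable {n : ℕ} {ω : Fin n → ℝ} {k : Edge n → ℝ} {T : ℝ}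
  {z : ℝ → (Edge n → ℝ) × (Edge n → ℝ)}

/-- The graph of the velocity is invariant. -/
lemma snd_eq_velocity (hz : IsIntegralCurveOn z (fun _ => field k) (Icc 0 T))
    (h0 : (z 0).2 = velocity ω k (z 0).1) : ∀ t ∈ Icc 0 T, (z t).2 = velocity ω k (z t).1 := by
  intro t ht
  have h := eq_of_hasDerivWithinAt_zero (f := fun t => (z t).2 - velocity ω k (z t).1)
    (fun t ht => by
      have h1 : HasDerivWithinAt (fun t => (z t).1) (field k (z t)).1 (Icc 0 T) t := (hz t ht).fst
      have h2 : HasDerivWithinAt (fun t => (z t).2) (field k (z t)).2 (Icc 0 T) t := (hz t ht).snd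
      have := h2.sub (hasDerivWithinAt_velocity ω k h1)
      rwa [show (field k (z t)).2 - gMatrix k (z t).1 *ᵥ (field k (z t)).1 = 0 from
        sub_self _] at this) t ht
  rw [h0, sub_self] at h
  exact sub_eq_zero.1 h

/-- The velocity lies in the column space, so any linear functional vanishing there is constant
along `X`; such functionals separate the subspace from points outside it. -/
lemma fst_mem_colSpace (hz : IsIntegralCurveOn z (fun _ => field k) (Icc 0 T))
    (h0 : (z 0).2 = velocity ω k (z 0).1) (hc : (z 0).1 ∈ colSpace n) :
    ∀ t ∈ Icc 0 T, (z t).1 ∈ colSpace n := by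
  intro t ht
  rw [← coe_colSubmodule] at hc ⊢
  by_contra hn
  obtain ⟨φ, hφ, hle⟩ := Submodule.exists_le_ker_of_notMem hn
  have h := eq_of_hasDerivWithinAt_zero (f := fun t => φ.toContinuousLinearMap (z t).1)
    (fun t ht => by
      have h1 := φ.toContinuousLinearMap.hasFDerivAt.comp_hasDerivWithinAt t (hz t ht).fst
      have h2 : φ.toContinuousLinearMap (field k (z t)).1 = 0 := by
        change φ (z t).2 = 0
        rw [snd_eq_velocity hz h0 t ht]
        exact hle (velocity_mem_colSpace ω k _)
      rwa [h2] at h1) t ht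
  refine hφ ?_
  change φ (z t).1 = φ (z 0).1 at h
  rw [h]
  exact hle hc

variable {δ η : ℝ}

/-- The phase differences stay within a cube that shrinks at a rate below `η`. -/
lemma abs_fst_le_barrier (hk : ∀ e, 0 ≤ k e) (hδ : 0 < δ)
    (hη : ∀ a b : Fin n, a ≠ b → (n : ℝ) * (|ω a - ω b| + η) ≤ pairGain k a b * Real.sin δ)
    (hz : IsIntegralCurveOn z (fun _ => field k) (Icc 0 T))
    (h0 : (z 0).2 = velocity ω k (z 0).1) (hc : (z 0).1 ∈ colSpace n)
    {b b' : ℝ → ℝ} (hb : ∀ t, HasDerivAt b (b' t) t)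
    (hb1 : ∀ t ∈ Icc 0 T, δ ≤ b t ∧ b t ≤ Real.pi - δ ∧ -η < b' t)
    (hi : ∀ e, |(z 0).1 e| ≤ b 0) : ∀ t ∈ Icc 0 T, ∀ e, |(z t).1 e| ≤ b t := by
  have hx : ∀ e, ∀ t ∈ Icc 0 T,
      HasDerivWithinAt (fun t => (z t).1 e) ((z t).2 e) (Icc 0 T) t := fun e t ht =>
    hasDerivWithinAt_pi.1 (hz t ht).fst e
  -- Two functions per edge, `X e - b` and `-X e - b`, one for each face of the moving cube.
  have main := nonpos_of_deriv_neg_of_eq_zero (ι := Edge n ⊕ Edge n) (T := T)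
    (g := Sum.elim (fun e t => (z t).1 e - b t) (fun e t => -(z t).1 e - b t))
    (g' := Sum.elim (fun e t => (z t).2 e - b' t) (fun e t => -(z t).2 e - b' t)) ?_ ?_ ?_
  · intro t ht e
    have h1 := main t ht (.inl e)
    have h2 := main t ht (.inr e)
    simp only [Sum.elim_inl, Sum.elim_inr] at h1 h2
    exact abs_le.2 ⟨by linarith, by linarith⟩
  · rintro (e | e) t ht
    · exact (hx e t ht).sub (hb t).hasDerivWithinAt
    · exact (hx e t ht).neg.sub (hb t).hasDerivWithinAt
  · intro t ht' hall i hi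
    have ht := Ico_subset_Icc_self ht'
    obtain ⟨hb1, hb2, hb3⟩ := hb1 t ht
    have habs : ∀ e, |(z t).1 e| ≤ b t := fun e => by
      have h1 := hall (.inl e)
      have h2 := hall (.inr e)
      simp only [Sum.elim_inl, Sum.elim_inr] at h1 h2
      exact abs_le.2 ⟨by linarith, by linarith⟩
    have hv := velocity_le_neg hk hδ hη (fst_mem_colSpace hz h0 hc t ht) hb1 hb2 habs
    rcases i with e | e
    · simp only [Sum.elim_inl] at hi ⊢
      rw [snd_eq_velocity hz h0 t ht]
      have := (hv e).1 (by linarith)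
      linarith
    · simp only [Sum.elim_inr] at hi ⊢
      rw [snd_eq_velocity hz h0 t ht]
      have := (hv e).2 (by linarith)
      linarith
  · rintro (e | e)
    · have := (abs_le.1 (hi e)).2
      simp only [Sum.elim_inl]; linarith
    · have := (abs_le.1 (hi e)).1
      simp only [Sum.elim_inr]; linarith

lemma abs_fst_le_of_initial (hk : ∀ e, 0 ≤ k e) (hδ : 0 < δ) (hη0 : 0 < η)
    (hη : ∀ a b : Fin n, a ≠ b → (n : ℝ) * (|ω a - ω b| + η) ≤ pairGain k a b * Real.sin δ)
    (hz : IsIntegralCurveOn z (fun _ => field k) (Icc 0 T))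
    (h0 : (z 0).2 = velocity ω k (z 0).1) (hc : (z 0).1 ∈ colSpace n)
    {r : ℝ} (h1 : δ ≤ r) (h2 : r ≤ Real.pi - δ)
    (hi : ∀ e, |(z 0).1 e| ≤ r) : ∀ t ∈ Icc 0 T, ∀ e, |(z t).1 e| ≤ r :=
  abs_fst_le_barrier hk hδ hη hz h0 hc (b := fun _ => r) (b' := fun _ => 0)
    (fun t => hasDerivAt_const t r) (fun _ _ => ⟨h1, h2, neg_lt_zero.2 hη0⟩) hi

lemma eventually_abs_fst_lt (hk : ∀ e, 0 ≤ k e) (hδ : 0 < δ) (hδ' : δ < Real.pi / 2) (hη0 : 0 < η)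
    (hη : ∀ a b : Fin n, a ≠ b → (n : ℝ) * (|ω a - ω b| + η) ≤ pairGain k a b * Real.sin δ)
    (hz : IsIntegralCurveOn z (fun _ => field k) (Ici 0))
    (h0 : (z 0).2 = velocity ω k (z 0).1) (hc : (z 0).1 ∈ colSpace n)
    (hi : ∀ e, |(z 0).1 e| ≤ Real.pi - δ) :
    ∀ᶠ t in atTop, ∀ e, |(z t).1 e| < Real.pi / 2 := by
  -- The barrier `δ + c exp (-γ t)` starts at `π - δ` and decreases to `δ < π/2`. Since `c < π`, its
  -- speed is at most `c γ < η`, so the flow never lags behind it.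
  set γ := η / Real.pi with hγ
  set c := Real.pi - 2 * δ with hc'
  have hγ0 : 0 < γ := div_pos hη0 Real.pi_pos
  have hc0 : 0 < c := by linarith
  have hb : ∀ t, HasDerivAt (fun t => δ + c * Real.exp (-γ * t))
      (c * (Real.exp (-γ * t) * (-γ * 1))) t := fun t =>
    ((((hasDerivAt_id t).const_mul (-γ)).exp).const_mul c).const_add δ
  have hlim : Tendsto (fun t => δ + c * Real.exp (-γ * t)) atTop (𝓝 (δ + c * 0)) :=
    ((Real.tendsto_exp_atBot.comp
      (tendsto_id.const_mul_atTop_of_neg (neg_lt_zero.2 hγ0))).const_mul c).const_add δ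
  rw [mul_zero, add_zero] at hlim
  filter_upwards [hlim.eventually (gt_mem_nhds hδ'), eventually_ge_atTop 0] with t ht ht0 e
  refine lt_of_le_of_lt ?_ ht
  refine abs_fst_le_barrier hk hδ hη (fun s hs => (hz s hs.1).mono Icc_subset_Ici_self) h0 hc hb
    (fun s hs => ?_) (by simpa [hc', two_mul, ← sub_sub] using hi) t ⟨ht0, le_rfl⟩ e
  have h1 : Real.exp (-γ * s) ≤ 1 := Real.exp_le_one_iff.2 (by nlinarith [hs.1])
  have h2 := Real.exp_pos (-γ * s)
  refine ⟨by nlinarith, by nlinarith, ?_⟩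
  have h3 : c * γ < η := by
    rw [hγ, mul_div_assoc', div_lt_iff₀ Real.pi_pos]
    nlinarith
  have h4 : 0 < c * γ := mul_pos hc0 hγ0
  nlinarith

end Flow

/-! ### Topology of the trapping set, and conclusion. -/

/-- The graph of the velocity over the closed cube of half-width `r` in the column space. -/
def velocityGraph {n : ℕ} (ω : Fin n → ℝ) (k : Edge n → ℝ) (r : ℝ) :
    Set ((Edge n → ℝ) × (Edge n → ℝ)) :=
  {z | (∀ e, |z.1 e| ≤ r) ∧ z.1 ∈ colSpace n ∧ z.2 = velocity ω k z.1}

section Graph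

variable {n : ℕ} (ω : Fin n → ℝ) (k : Edge n → ℝ) {r : ℝ}

lemma velocityGraph_eq_image : velocityGraph ω k r =
    (fun X => (X, velocity ω k X)) '' (Icc (fun _ => -r) (fun _ => r) ∩ colSpace n) := by
  ext ⟨X, V⟩
  simp only [velocityGraph, mem_ofPred_eq, mem_image, mem_inter_iff, Prod.mk.injEq, mem_Icc,
    Pi.le_def, abs_le, forall_and]
  constructor
  · rintro ⟨h1, h2, rfl⟩
    exact ⟨X, ⟨h1, h2⟩, rfl, rfl⟩
  · rintro ⟨_, ⟨h1, h2⟩, rfl, rfl⟩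
    exact ⟨h1, h2, rfl⟩

lemma isCompact_velocityGraph : IsCompact (velocityGraph ω k r) := by
  rw [velocityGraph_eq_image]
  exact (isCompact_Icc.inter_right (isClosed_colSpace n)).image
    (continuous_id.prodMk (continuous_velocity ω k))

lemma isConnected_velocityGraph (hr : 0 ≤ r) : IsConnected (velocityGraph ω k r) := by
  rw [velocityGraph_eq_image]
  refine IsConnected.image ⟨?_, ?_⟩ _
    (continuous_id.prodMk (continuous_velocity ω k)).continuousOn
  · exact ⟨0, ⟨fun _ => neg_nonpos.2 hr, fun _ => hr⟩, (colSubmodule n).zero_mem⟩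
  · exact ((convex_Icc _ _).inter (coe_colSubmodule n ▸ (colSubmodule n).convex)).isPreconnected

end Graph

end

end Kuramoto

theorem mainTheorem6 (n : ℕ) (ω : Fin n → ℝ) (k : Kuramoto.Edge n → ℝ) (δ : ℝ)
    (hk : ∀ e, 0 ≤ k e) (hδ : 0 < δ) (hδ' : δ < Real.pi / 2)
    (hgain : ∀ e, k e ≠ 0 → ((n : ℝ) - 2) / 2 * Kuramoto.gainSpread k ≤ k e)
    (hcond :
      1 / (n : ℝ) * ∑ e with 0 < k e,
          (2 * k e - ((n : ℝ) - 2) * Kuramoto.gainSpread k) * Real.sin |δ| >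
        ∑ e, |((Kuramoto.incidence n)ᵀ *ᵥ ω) e| +
          1 / (n : ℝ) * ∑ e : Kuramoto.Edge n with k e = 0,
            ((n : ℝ) - 2) * Kuramoto.gainSpread k) :
    ∃ T : Set ((Kuramoto.Edge n → ℝ) × (Kuramoto.Edge n → ℝ)),
      T.Nonempty ∧ IsConnected T ∧ IsCompact T ∧
      Kuramoto.PositivelyInvariant (Kuramoto.field k) T ∧
      T ⊆ Kuramoto.setM ω k δ ∧ Kuramoto.setH ω k ⊆ T ∧
      Kuramoto.IsAttractingSetIn (Kuramoto.field k) (Kuramoto.setM ω k δ)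
        (Kuramoto.setH ω k) T := by
  obtain ⟨η, hη0, hη⟩ := Kuramoto.exists_rate ω k hk hδ hδ' hcond
  have hCB := Kuramoto.couplingBound_of_rate hk hδ hδ' hη0 hη
  -- `r > π/2` makes the set a neighbourhood of the closure of `ℋ`; `r < π - δ` keeps it off the
  -- excluded lower faces of `ℳ`.
  obtain ⟨r, hr1, hr2⟩ := exists_between (show Real.pi / 2 < Real.pi - δ by linarith)
  have hpi := Real.pi_pos
  have hinv : Kuramoto.PositivelyInvariant (Kuramoto.field k) (Kuramoto.velocityGraph ω k r) := by
    rintro T z hz ⟨hi, hc, h0⟩ t ht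
    exact ⟨Kuramoto.abs_fst_le_of_initial hk hδ hη0 hη hz h0 hc (by linarith) hr2.le hi t ht,
      Kuramoto.fst_mem_colSpace hz h0 hc t ht, Kuramoto.snd_eq_velocity hz h0 t ht⟩
  have hTM : Kuramoto.velocityGraph ω k r ⊆ Kuramoto.setM ω k δ := by
    rintro z ⟨hi, hc, h0⟩
    refine ⟨fun e => ?_, hc, h0, hCB⟩
    have := abs_le.1 (hi e)
    exact ⟨by linarith, by linarith⟩
  have hcl : closure (Kuramoto.setH ω k) ⊆ Kuramoto.velocityGraph ω k (Real.pi / 2) := by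
    refine closure_minimal ?_ (Kuramoto.isCompact_velocityGraph ω k).isClosed
    rintro z ⟨hi, hc, h0, -⟩
    exact ⟨fun e => (abs_lt.2 (hi e)).le, hc, h0⟩
  have hsub : Kuramoto.velocityGraph ω k (Real.pi / 2) ⊆ Kuramoto.velocityGraph ω k r :=
    fun z hz => ⟨fun e => (hz.1 e).trans hr1.le, hz.2⟩
  refine ⟨_, (Kuramoto.isConnected_velocityGraph ω k (by linarith : 0 ≤ r)).nonempty,
    Kuramoto.isConnected_velocityGraph ω k (by linarith), Kuramoto.isCompact_velocityGraph ω k,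
    hinv, hTM, (subset_closure.trans hcl).trans hsub, ?_, hinv, (hcl.trans hsub).trans hTM, hTM,
    ?_, ?_⟩
  · rintro T z hz ⟨hi, hc, h0, -⟩ t ht
    refine ⟨?_, Kuramoto.fst_mem_colSpace hz h0 hc t ht, Kuramoto.snd_eq_velocity hz h0 t ht, hCB⟩
    -- The cube of `ℋ` is open, so the initial point already lies in a closed cube of half-width `d
    -- < π/2`, and `d` can be taken at least `δ` for that cube to be invariant.
    obtain ⟨d, hd, hd1, hd2⟩ : ∃ d, d < Real.pi / 2 ∧ δ ≤ d ∧ ∀ e, |(z 0).1 e| ≤ d := by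
      have hfin : ∀ᶠ d in 𝓝[<] (Real.pi / 2), ∀ e, |(z 0).1 e| ≤ d :=
        eventually_all.2 fun e => eventually_nhdsWithin_of_eventually_nhds
          ((lt_mem_nhds (abs_lt.2 (hi e))).mono fun _ h => h.le)
      have hδd : ∀ᶠ d in 𝓝[<] (Real.pi / 2), δ ≤ d :=
        eventually_nhdsWithin_of_eventually_nhds ((lt_mem_nhds hδ').mono fun _ h => h.le)
      obtain ⟨d, h1, h2, h3⟩ := (hfin.and (hδd.and self_mem_nhdsWithin)).exists
      exact ⟨d, h3, h2, h1⟩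
    exact fun e => abs_lt.1 ((Kuramoto.abs_fst_le_of_initial hk hδ hη0 hη hz h0 hc hd1
      (by linarith) hd2 t ht e).trans_lt hd)
  · intro x hx
    have hopen : IsOpen {z : (Kuramoto.Edge n → ℝ) × (Kuramoto.Edge n → ℝ) |
        ∀ e, |z.1 e| < r} := by
      simp only [ofPred_forall]
      exact isOpen_iInter_of_finite fun e => isOpen_lt (by fun_prop) continuous_const
    refine mem_nhdsWithin.2 ⟨_, hopen, fun e => ((hcl hx).1 e).trans_lt hr1, ?_⟩
    rintro z ⟨hz, -, hc, h0, -⟩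
    exact ⟨fun e => (hz e).le, hc, h0⟩
  · rintro z hz ⟨hi, hc, h0, -⟩ ε hε
    have hi' : ∀ e, |(z 0).1 e| ≤ Real.pi - δ := fun e =>
      abs_le.2 ⟨by linarith [(hi e).1], (hi e).2⟩
    filter_upwards [Kuramoto.eventually_abs_fst_lt hk hδ hδ' hη0 hη hz h0 hc hi',
      eventually_ge_atTop 0] with t ht ht0
    have hz' : IsIntegralCurveOn z (fun _ => Kuramoto.field k) (Icc 0 t) :=
      fun s hs => (hz s hs.1).mono Icc_subset_Ici_self
    exact Metric.self_subset_thickening hε _ ⟨fun e => abs_lt.1 (ht e),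
      Kuramoto.fst_mem_colSpace hz' h0 hc t ⟨ht0, le_rfl⟩,
      Kuramoto.snd_eq_velocity hz' h0 t ⟨ht0, le_rfl⟩, hCB⟩
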